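/- Let $n\ge 0$, $[n]=\{1,\dots,n\}$, and let $\mathcal D\subseteq\binom{[n]}{2}$ be a collection of $2$-subsets of $[n]$, with complement $\mathcal D^c=\binom{[n]}{2}\setminus\mathcal D$. For $\mathcal I\subseteq\binom{[n]}{2}$ let $S_+(\mathcal I)\subseteq \mathrm{Gr}_{\ge 0}(2,n)$ be the set of those $2$-dimensional subspaces of $\mathbb R^n$ that are the row space of a real $2\times n$ matrix $A$ of rank $2$ with $\det A[I]>0$ for all $I\in\mathcal I$ and $\det A[I]=0$ for all $I\in\binom{[n]}{2}\setminus\mathcal I$, where $A[I]$ is the submatrix of the columns indexed by $I$, in increasing order. The collection $\mathcal I$ is called a positroid if $S_+(\mathcal I)\ne\emptyset$, and then $S_+(\mathcal I)$ is called a positroid cell; it carries the subspace topology from the real Grassmannian $\mathrm{Gr}(2,n)$. Let $$T_{\mathcal D}=\{\,i\in[n] : \{i,j\}\in\mathcal D \text{ for all } j\in[n]\setminus\{i\}\,\},$$ let $G_{\mathcal D}$ be the graph with vertex set $[n]\setminus T_{\mathcal D}$ whose edges are the pairs $\{i,j\}\in\mathcal D$ with $i,j\in[n]\setminus T_{\mathcal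 D}$, and let $c(\mathcal D)$ be the number of connected components of $G_{\mathcal D}$ (isolated vertices are counted). **Proposition.** If $\mathcal D^c$ is a positroid, then the positroid cell $S_+(\mathcal D^c)$ is a topological cell of dimension $n-|T_{\mathcal D}|+c(\mathcal D)-4$; that is, this number is a non-negative integer $d$, and $S_+(\mathcal D^c)$ is homeomorphic to $\mathbb R^{d}$. -/

import Mathlib

namespace PositroidCells

/-- The real Grassmannian `Gr(k, n)`: the `k`-dimensional linear subspaces of `ℝⁿ`. -/
def Gr (k n : ℕ) : Type :=
  {V : Submodule ℝ (Fin n → ℝ) // Module.finrank ℝ V = k}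

/-- The full-rank real `k × n` matrices. -/
abbrev FullRank (k n : ℕ) : Type :=
  {A : Matrix (Fin k) (Fin n) ℝ // A.rank = k}

/-- The point of `Gr(k, n)` represented by a full-rank matrix: its row space. -/
def rowSpace {k n : ℕ} (A : FullRank k n) : Gr k n :=
  ⟨Submodule.span ℝ (Set.range A.1.row), by
    rw [← Matrix.rank_eq_finrank_span_row, A.2]⟩

/-- The usual topology on `Gr(k, n)`: the quotient topology coming from the full-rank matrices. -/
instance (k n : ℕ) : TopologicalSpace (Gr k n) :=
  TopologicalSpace.coinduced rowSpace inferInstance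

/-- The maximal minor `det A[I]` of a `k × n` matrix, whose columns are those indexed by the
`k`-subset `I`, taken in increasing order. -/
noncomputable def minor {k n : ℕ} (A : Matrix (Fin k) (Fin n) ℝ)
    (I : Set.powersetCard (Fin n) k) : ℝ :=
  (A.submatrix id (I.1.orderEmbOfFin I.2)).det

/-- The totally non-negative Grassmannian: the points that have a matrix representative all of
whose maximal minors are non-negative. -/
def GrNonneg (k n : ℕ) : Set (Gr k n) :=
  {V | ∃ A : FullRank k n, rowSpace A = V ∧ ∀ I, 0 ≤ minor A.1 I}

/-- The set `S₊(𝓘)`, for a collection `𝓘` of `k`-subsets of `[n]`: the points of `Gr(k, n)` with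
a matrix representative whose maximal minors are positive at the members of `𝓘` and zero
elsewhere. -/
def cell {k n : ℕ} (𝓘 : Set (Set.powersetCard (Fin n) k)) : Set (Gr k n) :=
  {V | ∃ A : FullRank k n, rowSpace A = V ∧
    ∀ I, (I ∈ 𝓘 → 0 < minor A.1 I) ∧ (I ∉ 𝓘 → minor A.1 I = 0)}

theorem cell_subset_grNonneg {k n : ℕ} (𝓘 : Set (Set.powersetCard (Fin n) k)) :
    cell 𝓘 ⊆ GrNonneg k n := by
  rintro V ⟨A, hA, h⟩
  refine ⟨A, hA, fun I => ?_⟩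
  by_cases hI : I ∈ 𝓘
  · exact ((h I).1 hI).le
  · exact ((h I).2 hI).ge

/-- `𝓘` is (the set of bases of) a positroid. -/
def IsPositroid {k n : ℕ} (𝓘 : Set (Set.powersetCard (Fin n) k)) : Prop :=
  (cell 𝓘).Nonempty

/-- `X` is an (open) topological cell of dimension `d`, i.e. homeomorphic to `ℝᵈ`. -/
def IsCellOfDim (X : Type*) [TopologicalSpace X] (d : ℕ) : Prop :=
  Nonempty (X ≃ₜ EuclideanSpace ℝ (Fin d))

/-- The pair `{i, j}` is one of the `2`-subsets in `D`. -/
def PairMem {n : ℕ} (D : Set (Set.powersetCard (Fin n) 2)) (i j : Fin n) : Prop :=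
  ∃ p ∈ D, p.1 = {i, j}

/-- The set `T_D = {i ∈ [n] | {i, j} ∈ D for all j ≠ i}`. -/
def loops {n : ℕ} (D : Set (Set.powersetCard (Fin n) 2)) : Set (Fin n) :=
  {i | ∀ j, j ≠ i → PairMem D i j}

/-- The graph `G_D` with vertex set `[n] \ T_D` whose edges are the pairs in `D` with both
elements in `[n] \ T_D`. -/
def graph {n : ℕ} (D : Set (Set.powersetCard (Fin n) 2)) :
    SimpleGraph {i : Fin n // i ∉ loops D} where
  Adj i j := PairMem D i.1 j.1
  symm := ⟨by
    rintro i j ⟨p, hp, h⟩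
    exact ⟨p, hp, by rw [h, Finset.pair_comm]⟩⟩
  loopless := ⟨by
    rintro i ⟨p, -, h⟩
    have h2 := Set.powersetCard.card_eq p
    rw [h] at h2
    simp at h2⟩

/-- The number `c(D)` of connected components of `G_D`, singletons included. -/
noncomputable def numComponents {n : ℕ} (D : Set (Set.powersetCard (Fin n) 2)) : ℕ :=
  Nat.card (graph D).ConnectedComponent

end PositroidCells

/-!
Write the columns of a representative matrix as vectors in the plane. The minors prescribed by `D`
say which columns vanish (the elements of `loops D`), which non-zero columns are parallel (the
edges of `graph D`, so that parallelism classes are its connected components), and in which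
direction one turns from a column to a later non-parallel one.

Let `j` be the first non-zero column and `k` the first column not parallel to it. Every point of
the cell has a unique representative whose columns `j` and `k` are the standard basis vectors; its
entries are ratios of minors with denominator the minor `{j, k}`, so they depend continuously on
the point (`continuousOn_plRatio`). In this representative
* a column parallel to `j` is `(± t, 0)` with `t > 0`, where the sign is forced: it is `+` to the
  left of `k` and `-` to the right of it;
* any other non-zero column is `t (-z, 1)` with `t > 0`, where `z` is constant on parallelism
  classes, strictly increases from one class to the next, and is `0` at `k`.

`Shape` records the combinatorial part of this picture, and `exists_shape` extracts it from one
point of the cell. Conversely, arbitrary values of `log t` (for the non-zero columns other than `j`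
and `k`) and of the logarithms of the jumps of `z` give a point of the cell. If `m` columns are
non-zero and there are `c` classes, these are `(m - 2) + (c - 2)` free real parameters, and
`Shape.cellHomeomorph` is the resulting homeomorphism.
-/

namespace PositroidCells

open Set Topology

variable {n : ℕ}

/-! ### Minors of `2 × n` matrices and coordinates on `Gr(2, n)` -/

/-- The Plücker coordinate `det (a_i, a_l)` of the columns `i`, `l`, for arbitrary (not necessarily
increasing) `i` and `l`. -/
def pl (A : Matrix (Fin 2) (Fin n) ℝ) (i l : Fin n) : ℝ :=
  A 0 i * A 1 l - A 0 l * A 1 i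

theorem minor_eq_pl (A : Matrix (Fin 2) (Fin n) ℝ) {i l : Fin n} (hil : i < l)
    (I : Set.powersetCard (Fin n) 2) (hI : I.1 = {i, l}) : minor A I = pl A i l := by
  have h0 : I.1.orderEmbOfFin I.2 0 ∈ I.1 := Finset.orderEmbOfFin_mem _ _ _
  have h1 : I.1.orderEmbOfFin I.2 1 ∈ I.1 := Finset.orderEmbOfFin_mem _ _ _
  have h01 : I.1.orderEmbOfFin I.2 0 < I.1.orderEmbOfFin I.2 1 :=
    (I.1.orderEmbOfFin I.2).strictMono (by decide)
  have key : I.1.orderEmbOfFin I.2 0 = i ∧ I.1.orderEmbOfFin I.2 1 = l := by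
    generalize I.1.orderEmbOfFin I.2 0 = x at *
    generalize I.1.orderEmbOfFin I.2 1 = y at *
    rw [hI] at h0 h1
    simp only [Finset.mem_insert, Finset.mem_singleton] at h0 h1
    rcases h0 with rfl | rfl <;> rcases h1 with rfl | rfl <;>
      first
      | exact ⟨rfl, rfl⟩
      | exact absurd h01 (lt_irrefl _)
      | exact absurd h01 (not_lt.mpr hil.le)
  simp [minor, Matrix.det_fin_two, pl, key.1, key.2]

/-- The sign conditions defining `cell Dᶜ`, in terms of `pl`. -/
def HasPattern (D : Set (Set.powersetCard (Fin n) 2)) (A : Matrix (Fin 2) (Fin n) ℝ) : Prop :=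
  ∀ i l, i < l → (¬ PairMem D i l → 0 < pl A i l) ∧ (PairMem D i l → pl A i l = 0)

theorem mem_cell_compl_iff (D : Set (Set.powersetCard (Fin n) 2)) (V : Gr 2 n) :
    V ∈ cell Dᶜ ↔ ∃ A : FullRank 2 n, rowSpace A = V ∧ HasPattern D A.1 := by
  refine exists_congr fun A => and_congr_right fun _ => ⟨fun h i l hil => ?_, fun h I => ?_⟩
  · let I : Set.powersetCard (Fin n) 2 := ⟨{i, l}, by
      simpa [Set.powersetCard] using Finset.card_pair hil.ne⟩
    have hI : PairMem D i l ↔ I ∈ D :=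
      ⟨fun ⟨p, hp, hpi⟩ => by rwa [show I = p from Subtype.ext hpi.symm], fun h => ⟨I, h, rfl⟩⟩
    rw [hI, ← minor_eq_pl A.1 hil I rfl]
    exact ⟨fun hn => (h I).1 hn, fun hn => (h I).2 (not_not.mpr hn)⟩
  · obtain ⟨x, y, hxy, hI⟩ := Finset.card_eq_two.mp I.2
    obtain ⟨i, l, hil, hI⟩ : ∃ i l, i < l ∧ I.1 = {i, l} := by
      rcases lt_or_gt_of_ne hxy with h' | h'
      · exact ⟨x, y, h', hI⟩
      · exact ⟨y, x, h', by rw [Finset.pair_comm]; exact hI⟩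
    have hD : PairMem D i l ↔ I ∈ D :=
      ⟨fun ⟨p, hp, hpi⟩ => by rwa [show I = p from Subtype.ext (hI.trans hpi.symm)],
        fun h => ⟨I, h, hI⟩⟩
    rw [minor_eq_pl A.1 hil I hI]
    have := h i l hil
    rw [hD] at this
    exact ⟨this.1, fun hn => this.2 (not_not.mp hn)⟩

theorem pl_mul (g : Matrix (Fin 2) (Fin 2) ℝ) (A : Matrix (Fin 2) (Fin n) ℝ) (i l : Fin n) :
    pl (g * A) i l = g.det * pl A i l := by
  simp only [pl, Matrix.mul_apply, Fin.sum_univ_two, Matrix.det_fin_two]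
  ring

/-- If all Plücker coordinates vanish, then the vanishing of `A 1 l • A 0 - A 0 l • A 1` for every `l`
is a dependency between the rows. -/
theorem rank_eq_two_iff (A : Matrix (Fin 2) (Fin n) ℝ) :
    A.rank = 2 ↔ ∃ i l, pl A i l ≠ 0 := by
  have hli : A.rank = 2 ↔ LinearIndependent ℝ A.row := by
    rw [linearIndependent_iff_card_eq_finrank_span, Matrix.rank_eq_finrank_span_row]
    simp [Set.finrank, eq_comm]
  have hrow : A.row = ![A 0, A 1] := by
    funext i; fin_cases i <;> rfl
  rw [hli, hrow, LinearIndependent.pair_iff]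
  constructor
  · intro h
    by_contra! hp
    have hz : ∀ l, A 1 l = 0 ∧ - A 0 l = 0 := fun l => h _ _ (by
      funext i
      have := hp i l
      simp only [pl] at this
      simp only [Pi.add_apply, Pi.smul_apply, smul_eq_mul, Pi.zero_apply]
      linarith)
    have := h 1 1 (by
      funext i
      have := hz i
      simp only [Pi.add_apply, Pi.smul_apply, smul_eq_mul, Pi.zero_apply]
      linarith)
    simp at this
  · rintro ⟨i, l, hp⟩ s t hst
    have hi := congrFun hst i
    have hl := congrFun hst l
    simp only [Pi.add_apply, Pi.smul_apply, smul_eq_mul, Pi.zero_apply] at hi hl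
    constructor
    · refine (mul_eq_zero.mp (?_ : s * pl A i l = 0)).resolve_right hp
      simp only [pl]; linear_combination A 1 l * hi - A 1 i * hl
    · refine (mul_eq_zero.mp (?_ : t * pl A i l = 0)).resolve_right hp
      simp only [pl]; linear_combination A 0 i * hl - A 0 l * hi

theorem exists_mul_eq_of_span_le {A B : Matrix (Fin 2) (Fin n) ℝ}
    (h : Submodule.span ℝ (Set.range B.row) ≤ Submodule.span ℝ (Set.range A.row)) :
    ∃ g : Matrix (Fin 2) (Fin 2) ℝ, B = g * A := by
  have : ∀ i, ∃ c : Fin 2 → ℝ, ∑ s, c s • A.row s = B.row i := fun i =>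
    (Submodule.mem_span_range_iff_exists_fun ℝ).mp (h (Submodule.subset_span ⟨i, rfl⟩))
  choose g hg using this
  refine ⟨Matrix.of g, ?_⟩
  ext i l
  have := congrFun (hg i) l
  simpa [Matrix.mul_apply, Finset.sum_apply] using this.symm

theorem rowSpace_eq_of_mul {A B : FullRank 2 n} {g : Matrix (Fin 2) (Fin 2) ℝ}
    (h : A.1 = g * B.1) : rowSpace A = rowSpace B := by
  apply Subtype.ext
  apply Submodule.eq_of_le_of_finrank_eq
  · rw [rowSpace, rowSpace, Submodule.span_le]
    rintro _ ⟨i, rfl⟩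
    have : A.1.row i = ∑ s, g i s • B.1.row s := by
      funext l
      simp [h, Matrix.mul_apply, Finset.sum_apply]
    rw [this]
    exact Submodule.sum_mem _ fun s _ => Submodule.smul_mem _ _ (Submodule.subset_span ⟨s, rfl⟩)
  · rw [(rowSpace A).2, (rowSpace B).2]

theorem rowSpace_surjective {k n : ℕ} : Function.Surjective (rowSpace : FullRank k n → Gr k n) := by
  rintro ⟨V, hV⟩
  let b := Module.finBasisOfFinrankEq ℝ V hV
  let A : Matrix (Fin k) (Fin n) ℝ := Matrix.of fun i => (b i : Fin n → ℝ)
  have hspan : Submodule.span ℝ (Set.range A.row) = V := by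
    have : Set.range A.row = V.subtype '' Set.range b := by
      rw [← Set.range_comp]; rfl
    rw [this, Submodule.span_image, b.span_eq, Submodule.map_top, Submodule.range_subtype]
  refine ⟨⟨A, ?_⟩, Subtype.ext hspan⟩
  rw [Matrix.rank_eq_finrank_span_row, hspan, hV]

theorem isQuotientMap_rowSpace {k n : ℕ} :
    IsQuotientMap (rowSpace : FullRank k n → Gr k n) :=
  ⟨⟨rfl⟩, rowSpace_surjective⟩

/-- Ratios of Plücker coordinates depend only on the row space. When the denominator vanishes for one
representative, it does for both, and both sides are `0`. -/
theorem pl_div_congr {A B : FullRank 2 n} (h : rowSpace A = rowSpace B) (j k i l : Fin n) :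
    pl A.1 i l / pl A.1 j k = pl B.1 i l / pl B.1 j k := by
  have h' := congrArg Subtype.val h
  obtain ⟨g, hg⟩ := exists_mul_eq_of_span_le (le_of_eq h')
  obtain ⟨g', hg'⟩ := exists_mul_eq_of_span_le (le_of_eq h'.symm)
  by_cases h0 : pl A.1 j k = 0
  · have hB : pl B.1 j k = 0 := by rw [hg', pl_mul, h0, mul_zero]
    rw [h0, hB, div_zero, div_zero]
  · rw [hg, pl_mul] at h0
    rw [hg, pl_mul, pl_mul, mul_div_mul_left _ _ (left_ne_zero_of_mul h0)]

/-- The ratio of the Plücker coordinates `(i, l)` and `(j, k)`, as a function on `Gr(2, n)`. It is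
the junk value `0` where the coordinate `(j, k)` vanishes. -/
noncomputable def plRatio (j k i l : Fin n) (V : Gr 2 n) : ℝ :=
  pl (rowSpace_surjective V).choose.1 i l / pl (rowSpace_surjective V).choose.1 j k

theorem plRatio_rowSpace (j k i l : Fin n) (A : FullRank 2 n) :
    plRatio j k i l (rowSpace A) = pl A.1 i l / pl A.1 j k :=
  pl_div_congr (rowSpace_surjective (rowSpace A)).choose_spec j k i l

theorem continuous_pl (i l : Fin n) : Continuous fun A : FullRank 2 n => pl A.1 i l := by
  unfold pl
  have h : ∀ s t, Continuous fun A : FullRank 2 n => A.1 s t := fun s t =>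
    (continuous_apply_apply s t).comp continuous_subtype_val
  exact ((h _ _).mul (h _ _)).sub ((h _ _).mul (h _ _))

/-- The set on which `plRatio j k j k` is non-zero (hence `1`) is the affine chart where the Plücker
coordinate `(j, k)` does not vanish. -/
theorem continuousOn_plRatio (j k i l : Fin n) :
    ContinuousOn (plRatio j k i l) {V | plRatio j k j k V ≠ 0} := by
  have hpre : (rowSpace : FullRank 2 n → Gr 2 n) ⁻¹' {V | plRatio j k j k V ≠ 0}
      = {A | pl A.1 j k ≠ 0} := by
    ext A; simp [plRatio_rowSpace]
  have hopen : IsOpen {V : Gr 2 n | plRatio j k j k V ≠ 0} := by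
    rw [← isQuotientMap_rowSpace.isOpen_preimage, hpre]
    exact isOpen_ne_fun (continuous_pl j k) continuous_const
  rw [isQuotientMap_rowSpace.continuousOn_isOpen_iff hopen, hpre]
  refine ContinuousOn.congr (f := fun A : FullRank 2 n => pl A.1 i l / pl A.1 j k) ?_ ?_
  · exact (continuous_pl i l).continuousOn.div (continuous_pl j k).continuousOn fun _ h => h
  · intro A _; exact plRatio_rowSpace j k i l A

/-- The representative whose columns `j` and `k` are the standard basis vectors: by Cramer's rule its
entries are the ratios of Plücker coordinates on the right-hand sides. -/
theorem rowSpace_eq_of_normal {j k : Fin n} {A B : FullRank 2 n}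
    (h0 : ∀ i, A.1 0 i = pl B.1 i k / pl B.1 j k) (h1 : ∀ i, A.1 1 i = pl B.1 j i / pl B.1 j k) :
    rowSpace A = rowSpace B := by
  -- The multiplier is the inverse of the submatrix of the columns `j` and `k`.
  refine rowSpace_eq_of_mul
    (g := (pl B.1 j k)⁻¹ • !![B.1 1 k, -B.1 0 k; -B.1 1 j, B.1 0 j]) ?_
  ext s i
  fin_cases s
  · simp [h0, pl, Matrix.mul_apply, Fin.sum_univ_two, div_eq_inv_mul]; ring
  · simp [h1, pl, Matrix.mul_apply, Fin.sum_univ_two, div_eq_inv_mul]; ring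

/-! ### The combinatorial shape of a rank two positroid -/

/-- The combinatorics of the columns of the matrices in `cell Dᶜ`, with `r + 2` parallelism classes of
non-zero columns. The set `C` is the class of the column `j`, and `M` is the set of all other
non-zero columns; `ρ` numbers the classes in `M` from left to right, starting with that of `k`, and
its values outside `M` are irrelevant. By `lt_iff`, each element of `C` lies to the left of all of
`M` or to the right of all of `M`. -/
structure Shape (D : Set (Set.powersetCard (Fin n) 2)) (r : ℕ) where
  C : Finset (Fin n)
  M : Finset (Fin n)
  j : Fin n
  k : Fin n
  ρ : Fin n → Fin (r + 1)
  disj : ∀ i ∈ C, i ∉ M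
  j_mem : j ∈ C
  k_mem : k ∈ M
  j_lt_k : j < k
  ρ_k : ρ k = 0
  lt_iff : ∀ i ∈ C, ∀ l ∈ M, i < l ↔ i < k
  ρ_mono : ∀ i ∈ M, ∀ l ∈ M, i ≤ l → ρ i ≤ ρ l
  ρ_surj : ∀ s, ∃ l ∈ M, ρ l = s
  pairMem_iff : ∀ i l, i ≠ l → (PairMem D i l ↔
    ¬ ((i ∈ C ∧ l ∈ M) ∨ (i ∈ M ∧ l ∈ C) ∨ (i ∈ M ∧ l ∈ M ∧ ρ i ≠ ρ l)))

theorem PairMem.symm {D : Set (Set.powersetCard (Fin n) 2)} {i l : Fin n} (h : PairMem D i l) :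
    PairMem D l i := by
  obtain ⟨p, hp, h⟩ := h
  exact ⟨p, hp, by rw [h, Finset.pair_comm]⟩

/-- The shape read off from a matrix with columns `(a i, b i)` in normal form. The class of a column
in `M` is the rank of its slope `- a i / b i` among all slopes that occur. -/
theorem exists_shape_of_normal (D : Set (Set.powersetCard (Fin n) 2)) (a b : Fin n → ℝ)
    (j k : Fin n) (haj : a j = 1) (hbj : b j = 0) (hbk : b k = 1)
    (hb : ∀ i, 0 ≤ b i) (hjk : j < k) (hk : ∀ i, b i ≠ 0 → k ≤ i)
    (hq : ∀ i l, i < l → 0 ≤ a i * b l - a l * b i)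
    (hD : ∀ i l, i ≠ l → (PairMem D i l ↔ a i * b l - a l * b i = 0)) :
    ∃ r, Nonempty (Shape D r) := by
  classical
  set z : Fin n → ℝ := fun i => - a i / b i with hz
  set M : Finset (Fin n) := Finset.univ.filter fun i => b i ≠ 0 with hM
  have memM : ∀ i, i ∈ M ↔ b i ≠ 0 := by simp [hM]
  have hbpos : ∀ i ∈ M, 0 < b i := fun i hi => lt_of_le_of_ne (hb i) (Ne.symm ((memM i).mp hi))
  set Z : Finset ℝ := M.image z with hZ
  have hkM : k ∈ M := by rw [memM, hbk]; exact one_ne_zero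
  obtain ⟨r, hr⟩ : ∃ r, Z.card = r + 1 :=
    Nat.exists_eq_succ_of_ne_zero (Finset.card_ne_zero_of_mem (Finset.mem_image_of_mem z hkM))
  let e := Z.orderIsoOfFin hr
  let ρ : Fin n → Fin (r + 1) := fun i =>
    if h : i ∈ M then e.symm ⟨z i, Finset.mem_image_of_mem z h⟩ else 0
  have hρle : ∀ i ∈ M, ∀ l ∈ M, (ρ i ≤ ρ l ↔ z i ≤ z l) := by
    intro i hi l hl
    simp [ρ, hi, hl]
  have hzq : ∀ i ∈ M, ∀ l ∈ M, a i * b l - a l * b i = b i * b l * (z l - z i) := by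
    intro i hi l hl
    have := (hbpos i hi).ne'
    have := (hbpos l hl).ne'
    simp only [hz]; field_simp; ring
  have hmono : ∀ i ∈ M, ∀ l ∈ M, i ≤ l → ρ i ≤ ρ l := by
    intro i hi l hl hil
    rw [hρle i hi l hl]
    rcases hil.eq_or_lt with rfl | hil
    · exact le_rfl
    · have := hq i l hil
      rw [hzq i hi l hl] at this
      exact sub_nonneg.mp (nonneg_of_mul_nonneg_right this (mul_pos (hbpos i hi) (hbpos l hl)))
  have hsurj : ∀ s, ∃ l ∈ M, ρ l = s := by
    intro s
    obtain ⟨l, hl, hls⟩ := Finset.mem_image.mp (e s).2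
    refine ⟨l, hl, ?_⟩
    simp only [ρ, hl, dif_pos, hls]
    simp
  -- The columns of `M` are in the upper half-plane: they are counterclockwise from `(a i, 0)` if
  -- `a i > 0` and clockwise if `a i < 0`.
  have hside : ∀ i, b i = 0 → a i ≠ 0 → ∀ l ∈ M, (i < l ↔ 0 < a i) := by
    intro i hi hai l hl
    have hil : i ≠ l := by rintro rfl; exact (memM i).mp hl hi
    constructor
    · intro h
      have := hq i l h
      rw [hi, mul_zero, sub_zero] at this
      exact lt_of_le_of_ne (nonneg_of_mul_nonneg_left this (hbpos l hl)) hai.symm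
    · intro h
      by_contra hn
      have h' := hq l i (lt_of_le_of_ne (not_lt.mp hn) hil.symm)
      rw [hi, mul_zero, zero_sub] at h'
      have := mul_pos h (hbpos l hl)
      linarith
  refine ⟨r, ⟨{
    C := Finset.univ.filter fun i => b i = 0 ∧ a i ≠ 0
    M := M, j := j, k := k, ρ := ρ
    disj := ?_, j_mem := ?_, k_mem := hkM, j_lt_k := hjk, ρ_k := ?_, lt_iff := ?_
    ρ_mono := hmono, ρ_surj := hsurj, pairMem_iff := ?_ }⟩⟩
  · intro i hi
    rw [memM]; simp only [Finset.mem_filter] at hi; simp [hi]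
  · simp [haj, hbj]
  · obtain ⟨l, hl, hl0⟩ := hsurj 0
    exact le_antisymm (hl0 ▸ hmono k hkM l hl (hk l ((memM l).mp hl))) (Fin.zero_le _)
  · intro i hi l hl
    simp only [Finset.mem_filter, Finset.mem_univ, true_and] at hi
    rw [hside i hi.1 hi.2 l hl, hside i hi.1 hi.2 k hkM]
  · intro i l hil
    rw [hD i l hil]
    have hρne : i ∈ M → l ∈ M → (ρ i = ρ l ↔ a i * b l - a l * b i = 0) := by
      intro hi hl
      rw [hzq i hi l hl, le_antisymm_iff, hρle i hi l hl, hρle l hl i hi, ← le_antisymm_iff]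
      simp only [mul_eq_zero, (hbpos i hi).ne', (hbpos l hl).ne', false_or, sub_eq_zero, eq_comm]
    by_cases hi : b i = 0 <;> by_cases hl : b l = 0
    · simp [memM, hi, hl]
    · simp [memM, hi, hl]
    · simp [memM, hi, hl]
    · have := hρne ((memM i).2 hi) ((memM l).2 hl)
      simp [memM, hi, hl, this]

theorem exists_shape (D : Set (Set.powersetCard (Fin n) 2)) (hD : IsPositroid Dᶜ) :
    ∃ r, Nonempty (Shape D r) := by
  classical
  obtain ⟨V, hV⟩ := hD
  obtain ⟨A, -, hA⟩ := (mem_cell_compl_iff D V).mp hV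
  have hanti : ∀ i l, pl A.1 i l = - pl A.1 l i := fun i l => by simp only [pl]; ring
  have hnn : ∀ i l, i < l → 0 ≤ pl A.1 i l := fun i l h => by
    by_cases hp : PairMem D i l
    · exact ((hA i l h).2 hp).ge
    · exact ((hA i l h).1 hp).le
  have hiff : ∀ i l, i ≠ l → (PairMem D i l ↔ pl A.1 i l = 0) := by
    have : ∀ i l, i < l → (PairMem D i l ↔ pl A.1 i l = 0) := fun i l h =>
      ⟨(hA i l h).2, fun h0 => by_contra fun hp => ((hA i l h).1 hp).ne' h0⟩
    intro i l h
    rcases lt_or_gt_of_ne h with h | h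
    · exact this i l h
    · rw [hanti, neg_eq_zero, ← this l i h]
      exact ⟨PairMem.symm, PairMem.symm⟩
  obtain ⟨x, y, hxy⟩ := (rank_eq_two_iff A.1).mp A.2
  -- `j` is the first non-zero column.
  obtain ⟨j, hj, hjmin⟩ : ∃ j, (A.1 0 j ≠ 0 ∨ A.1 1 j ≠ 0) ∧
      ∀ i < j, A.1 0 i = 0 ∧ A.1 1 i = 0 := by
    have hne : (Finset.univ.filter fun i => A.1 0 i ≠ 0 ∨ A.1 1 i ≠ 0).Nonempty := by
      refine ⟨x, ?_⟩
      simp only [Finset.mem_filter, Finset.mem_univ, true_and]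
      by_contra! h
      exact hxy (by simp [pl, h.1, h.2])
    refine ⟨_, (Finset.mem_filter.mp (Finset.min'_mem _ hne)).2, fun i hi => ?_⟩
    by_contra h
    refine absurd (Finset.min'_le _ i ?_) (not_le.mpr hi)
    simp only [Finset.mem_filter, Finset.mem_univ, true_and]
    tauto
  -- `k` is the first column that is not parallel to column `j`.
  obtain ⟨k, hk, hkmin⟩ : ∃ k, pl A.1 j k ≠ 0 ∧ ∀ i, pl A.1 j i ≠ 0 → k ≤ i := by
    have hne : (Finset.univ.filter fun i => pl A.1 j i ≠ 0).Nonempty := by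
      by_contra h
      have h0 : ∀ i, pl A.1 j i = 0 := by
        simpa [Finset.filter_eq_empty_iff] using h
      have h0x := h0 x
      have h0y := h0 y
      simp only [pl] at h0x h0y
      apply hxy
      rcases hj with hj | hj
      · refine (mul_eq_zero.mp (?_ : A.1 0 j * pl A.1 x y = 0)).resolve_left hj
        simp only [pl]; linear_combination A.1 0 x * h0y - A.1 0 y * h0x
      · refine (mul_eq_zero.mp (?_ : A.1 1 j * pl A.1 x y = 0)).resolve_left hj
        simp only [pl]; linear_combination A.1 1 x * h0y - A.1 1 y * h0x
    exact ⟨_, (Finset.mem_filter.mp (Finset.min'_mem _ hne)).2, fun i hi =>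
      Finset.min'_le _ i (by simpa using hi)⟩
  have hzero : ∀ i ≤ j, pl A.1 j i = 0 := by
    intro i hi
    rcases hi.eq_or_lt with rfl | hi
    · simp [pl]
    · simp [pl, hjmin i hi]
  have hjk : j < k := by
    by_contra h
    exact hk (hzero k (not_lt.mp h))
  have hpos : 0 < pl A.1 j k := lt_of_le_of_ne (hnn j k hjk) hk.symm
  -- The three-term Plücker relation: normalizing divides every minor by the minor `{j, k}`.
  have hplq : ∀ i l, pl A.1 i k / pl A.1 j k * (pl A.1 j l / pl A.1 j k) -
      pl A.1 l k / pl A.1 j k * (pl A.1 j i / pl A.1 j k) = pl A.1 i l / pl A.1 j k := by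
    intro i l
    field_simp
    simp only [pl]; ring
  refine exists_shape_of_normal D (fun i => pl A.1 i k / pl A.1 j k)
    (fun i => pl A.1 j i / pl A.1 j k) j k (div_self hk) ?_ (div_self hk) ?_ hjk ?_ ?_ ?_
  · simp [hzero j le_rfl]
  · intro i
    refine div_nonneg ?_ hpos.le
    rcases le_or_gt i j with h | h
    · exact (hzero i h).ge
    · exact hnn j i h
  · intro i hi
    exact hkmin i fun h => hi (by simp [h])
  · intro i l hil
    rw [hplq]; exact div_nonneg (hnn i l hil) hpos.le
  · intro i l hil
    rw [hplq, hiff i l hil]; simp [hk]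

/-- A graph in which adjacency is equality of labels has one component per label. -/
theorem card_connectedComponent_of_adj_iff {V X : Type*} (G : SimpleGraph V) (f : V → X)
    (hf : Function.Surjective f) (hG : ∀ v w, G.Adj v w ↔ v ≠ w ∧ f v = f w) :
    Nat.card G.ConnectedComponent = Nat.card X := by
  have hreach : ∀ v w, G.Reachable v w → f v = f w := by
    rintro v w ⟨p⟩
    induction p with
    | nil => rfl
    | cons h _ ih => exact ((hG _ _).mp h).2.trans ih
  refine Nat.card_eq_of_bijective
    (fun c => c.lift f fun v w p _ => hreach v w p.reachable) ⟨fun c d => ?_, fun x => ?_⟩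
  · induction c, d using SimpleGraph.ConnectedComponent.ind₂ with
    | _ v w =>
      intro h
      by_cases hvw : v = w
      · rw [hvw]
      · exact SimpleGraph.ConnectedComponent.sound ((hG v w).mpr ⟨hvw, h⟩).reachable
  · obtain ⟨v, rfl⟩ := hf x
    exact ⟨G.connectedComponentMk v, rfl⟩

namespace Shape

variable {D : Set (Set.powersetCard (Fin n) 2)} {r : ℕ}

theorem not_mem_loops_iff (S : Shape D r) (i : Fin n) : i ∉ loops D ↔ i ∈ S.C ∨ i ∈ S.M := by
  simp only [loops, mem_ofPred_eq, not_forall]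
  constructor
  · rintro ⟨l, hl, h⟩
    rw [S.pairMem_iff i l hl.symm] at h
    tauto
  · rintro (h | h)
    · have : S.k ≠ i := by rintro rfl; exact S.disj _ h S.k_mem
      refine ⟨S.k, this, ?_⟩
      rw [S.pairMem_iff _ _ this.symm]
      have := S.k_mem
      tauto
    · have : S.j ≠ i := by rintro rfl; exact S.disj _ S.j_mem h
      refine ⟨S.j, this, ?_⟩
      rw [S.pairMem_iff _ _ this.symm]
      have := S.j_mem
      tauto

theorem ncard_loops (S : Shape D r) : (loops D).ncard = n - (S.C.card + S.M.card) := by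
  classical
  have : loops D = ((S.C ∪ S.M)ᶜ : Finset (Fin n)) := by
    ext i
    have := S.not_mem_loops_iff i
    simp only [Finset.coe_compl, Finset.coe_union, mem_compl_iff, mem_union, SetLike.mem_coe]
    tauto
  rw [this, Set.ncard_coe_finset, Finset.card_compl, Fintype.card_fin,
    Finset.card_union_of_disjoint (Finset.disjoint_left.mpr S.disj)]

theorem numComponents_eq (S : Shape D r) : numComponents D = r + 2 := by
  classical
  let f : {i : Fin n // i ∉ loops D} → Option (Fin (r + 1)) := fun i =>
    if i.1 ∈ S.M then some (S.ρ i.1) else none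
  have h := card_connectedComponent_of_adj_iff (graph D) f ?_ ?_
  · rw [numComponents, h]; simp
  · rintro (_ | s)
    · exact ⟨⟨S.j, (S.not_mem_loops_iff _).mpr (Or.inl S.j_mem)⟩, by
        simp [f, S.disj _ S.j_mem]⟩
    · obtain ⟨l, hl, hls⟩ := S.ρ_surj s
      exact ⟨⟨l, (S.not_mem_loops_iff _).mpr (Or.inr hl)⟩, by simp [f, hl, hls]⟩
  · rintro ⟨i, hi⟩ ⟨l, hl⟩
    rw [S.not_mem_loops_iff] at hi hl
    by_cases hil : i = l
    · subst hil; simp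
    · have h1 : (graph D).Adj ⟨i, (S.not_mem_loops_iff i).mpr hi⟩
          ⟨l, (S.not_mem_loops_iff l).mpr hl⟩ ↔ PairMem D i l := Iff.rfl
      rw [h1, S.pairMem_iff i l hil]
      have hi' := S.disj i
      have hl' := S.disj l
      by_cases hiM : i ∈ S.M <;> by_cases hlM : l ∈ S.M <;>
        simp only [hiM, hlM, or_true, or_false] at hi hl <;> simp_all [f]

/-! ### The parametrization of the cell -/

/-- The non-zero columns other than `j` and `k`, whose scales are free parameters. -/
abbrev Free (S : Shape D r) : Type := {i : Fin n // (i ∈ S.C ∨ i ∈ S.M) ∧ i ≠ S.j ∧ i ≠ S.k}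

/-- The parameter space: logarithms of the scales of the free columns, and of the `r` jumps between
the slopes of consecutive classes in `M`. -/
abbrev Params (S : Shape D r) : Type := (S.Free → ℝ) × (Fin r → ℝ)

open Classical in
/-- The logarithm of the scale `t` of each column, which is `0` for the columns `j` and `k`. A column
of scale `t` is `(± t, 0)` if it is in `C`, and `t (-z, 1)` with `z` its slope if it is in `M`. -/
noncomputable def logScale (S : Shape D r) (x : S.Params) (i : Fin n) : ℝ :=
  if h : (i ∈ S.C ∨ i ∈ S.M) ∧ i ≠ S.j ∧ i ≠ S.k then x.1 ⟨i, h⟩ else 0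

/-- The slope of each class in `M`: the class of `k` has slope `0`, and the jumps are the exponentials
of the parameters. -/
noncomputable def slope (S : Shape D r) (x : S.Params) (s : Fin (r + 1)) : ℝ :=
  Fin.partialSum (fun l => Real.exp (x.2 l)) s

/-- The direction, relative to the column `j`, of a column parallel to it. -/
noncomputable def sign (S : Shape D r) (i : Fin n) : ℝ := if i < S.k then 1 else -1

/-- The matrix in normal form with the given parameters. -/
noncomputable def mat (S : Shape D r) (x : S.Params) : Matrix (Fin 2) (Fin n) ℝ :=
  Matrix.of ![fun i => if i ∈ S.C then S.sign i * Real.exp (S.logScale x i)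
      else if i ∈ S.M then - (Real.exp (S.logScale x i) * S.slope x (S.ρ i)) else 0,
    fun i => if i ∈ S.M then Real.exp (S.logScale x i) else 0]

theorem mat_zero_of_mem_C (S : Shape D r) (x : S.Params) {i : Fin n} (hi : i ∈ S.C) :
    S.mat x 0 i = S.sign i * Real.exp (S.logScale x i) := by
  simp [mat, hi]

theorem mat_one_of_mem_C (S : Shape D r) (x : S.Params) {i : Fin n} (hi : i ∈ S.C) :
    S.mat x 1 i = 0 := by
  simp [mat, S.disj i hi]

theorem mat_zero_of_mem_M (S : Shape D r) (x : S.Params) {i : Fin n} (hi : i ∈ S.M) :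
    S.mat x 0 i = - (Real.exp (S.logScale x i) * S.slope x (S.ρ i)) := by
  have : i ∉ S.C := fun h => S.disj i h hi
  simp [mat, hi, this]

theorem mat_one_of_mem_M (S : Shape D r) (x : S.Params) {i : Fin n} (hi : i ∈ S.M) :
    S.mat x 1 i = Real.exp (S.logScale x i) := by
  simp [mat, hi]

theorem mat_of_not_mem (S : Shape D r) (x : S.Params) {i : Fin n} (hC : i ∉ S.C) (hM : i ∉ S.M)
    (s : Fin 2) : S.mat x s i = 0 := by
  fin_cases s <;> simp [mat, hC, hM]

theorem slope_zero (S : Shape D r) (x : S.Params) : S.slope x 0 = 0 :=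
  Fin.partialSum_zero _

theorem slope_succ (S : Shape D r) (x : S.Params) (s : Fin r) :
    S.slope x s.succ = S.slope x s.castSucc + Real.exp (x.2 s) :=
  Fin.partialSum_succ _ s

theorem strictMono_slope (S : Shape D r) (x : S.Params) : StrictMono (S.slope x) := by
  rw [Fin.strictMono_iff_lt_succ]
  intro s
  rw [slope_succ]
  exact lt_add_of_pos_right _ (Real.exp_pos _)

theorem logScale_j (S : Shape D r) (x : S.Params) : S.logScale x S.j = 0 := by
  simp [logScale]

theorem logScale_k (S : Shape D r) (x : S.Params) : S.logScale x S.k = 0 := by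
  simp [logScale]

theorem sign_j (S : Shape D r) : S.sign S.j = 1 := by
  simp [sign, S.j_lt_k]

theorem pl_mat_j (S : Shape D r) (x : S.Params) (i : Fin n) :
    pl (S.mat x) S.j i = S.mat x 1 i := by
  simp [pl, S.mat_zero_of_mem_C x S.j_mem, S.mat_one_of_mem_C x S.j_mem, logScale_j, sign_j]

theorem pl_mat_k (S : Shape D r) (x : S.Params) (i : Fin n) :
    pl (S.mat x) i S.k = S.mat x 0 i := by
  simp [pl, S.mat_zero_of_mem_M x S.k_mem, S.mat_one_of_mem_M x S.k_mem, logScale_k, S.ρ_k,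
    slope_zero]

theorem pl_mat_j_k (S : Shape D r) (x : S.Params) : pl (S.mat x) S.j S.k = 1 := by
  rw [pl_mat_j, S.mat_one_of_mem_M x S.k_mem, logScale_k, Real.exp_zero]

/-- `mat`, as a full-rank matrix. -/
noncomputable def fullMat (S : Shape D r) (x : S.Params) : FullRank 2 n :=
  ⟨S.mat x, (rank_eq_two_iff _).mpr ⟨S.j, S.k, by rw [pl_mat_j_k]; exact one_ne_zero⟩⟩

theorem hasPattern_mat (S : Shape D r) (x : S.Params) : HasPattern D (S.mat x) := by
  intro i l hil
  have hexp : ∀ i, 0 < Real.exp (S.logScale x i) := fun i => Real.exp_pos _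
  rw [S.pairMem_iff i l hil.ne, not_not]
  by_cases hiC : i ∈ S.C
  · have hiM := S.disj i hiC
    by_cases hlM : l ∈ S.M
    · have hsg : S.sign i = 1 := if_pos ((S.lt_iff i hiC l hlM).mp hil)
      have : 0 < pl (S.mat x) i l := by
        rw [pl, S.mat_zero_of_mem_C x hiC, S.mat_one_of_mem_C x hiC, S.mat_one_of_mem_M x hlM, hsg]
        have := mul_pos (hexp i) (hexp l)
        linarith
      simp [hiC, hlM, this]
    · have : pl (S.mat x) i l = 0 := by
        have hl : S.mat x 1 l = 0 := by simp [mat, hlM]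
        rw [pl, S.mat_one_of_mem_C x hiC, hl, mul_zero, mul_zero, sub_zero]
      simp [hiM, hlM, this]
  by_cases hiM : i ∈ S.M
  · by_cases hlC : l ∈ S.C
    · have hsg : S.sign l = -1 := by
        refine if_neg fun h => ?_
        exact absurd ((S.lt_iff l hlC i hiM).mpr h) (not_lt.mpr hil.le)
      have : 0 < pl (S.mat x) i l := by
        rw [pl, S.mat_zero_of_mem_C x hlC, S.mat_one_of_mem_C x hlC, S.mat_one_of_mem_M x hiM, hsg]
        have := mul_pos (hexp i) (hexp l)
        linarith
      simp [hiM, hlC, this]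
    by_cases hlM : l ∈ S.M
    · have hpl : pl (S.mat x) i l = Real.exp (S.logScale x i) * Real.exp (S.logScale x l) *
          (S.slope x (S.ρ l) - S.slope x (S.ρ i)) := by
        rw [pl, S.mat_zero_of_mem_M x hiM, S.mat_zero_of_mem_M x hlM, S.mat_one_of_mem_M x hiM,
          S.mat_one_of_mem_M x hlM]
        ring
      rw [hpl]
      simp only [hiM, hlM, hiC, hlC, true_and, false_and, false_or, and_false]
      constructor
      · intro h
        have := S.strictMono_slope x (lt_of_le_of_ne (S.ρ_mono i hiM l hlM hil.le) h)
        exact mul_pos (mul_pos (hexp i) (hexp l)) (sub_pos.mpr this)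
      · intro h
        rw [not_not] at h
        rw [h, sub_self, mul_zero]
    · simp [hlC, hlM, pl, S.mat_of_not_mem x hlC hlM]
  · simp [hiC, hiM, pl, S.mat_of_not_mem x hiC hiM]

theorem continuous_slope (S : Shape D r) (s : Fin (r + 1)) :
    Continuous fun x : S.Params => S.slope x s := by
  induction s using Fin.induction with
  | zero => simpa only [slope_zero] using continuous_const
  | succ s ih => simp only [slope_succ]; fun_prop

theorem continuous_mat (S : Shape D r) : Continuous S.mat := by
  have hu : ∀ i, Continuous fun x : S.Params => S.logScale x i := by
    intro i
    unfold logScale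
    split_ifs <;> fun_prop
  refine continuous_matrix fun s i => ?_
  have := hu i
  have := S.continuous_slope (S.ρ i)
  fin_cases s
  · simp only [mat, Fin.zero_eta, Matrix.of_apply, Matrix.cons_val_zero]
    split_ifs <;> fun_prop
  · change Continuous fun x : S.Params => if i ∈ S.M then Real.exp (S.logScale x i) else 0
    split_ifs <;> fun_prop

theorem continuous_fullMat (S : Shape D r) : Continuous S.fullMat :=
  S.continuous_mat.subtype_mk _

/-- A column in each class in `M`. -/
noncomputable def rep (S : Shape D r) (s : Fin (r + 1)) : Fin n := (S.ρ_surj s).choose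

theorem rep_mem (S : Shape D r) (s : Fin (r + 1)) : S.rep s ∈ S.M := (S.ρ_surj s).choose_spec.1

theorem ρ_rep (S : Shape D r) (s : Fin (r + 1)) : S.ρ (S.rep s) = s := (S.ρ_surj s).choose_spec.2

/-- The first row of the representative of `V` in which the columns `j` and `k` are the standard basis
vectors. -/
noncomputable def coord₀ (S : Shape D r) (V : Gr 2 n) (i : Fin n) : ℝ := plRatio S.j S.k i S.k V

/-- The second row of the representative of `V` in which the columns `j` and `k` are the standard basis
vectors. -/
noncomputable def coord₁ (S : Shape D r) (V : Gr 2 n) (i : Fin n) : ℝ := plRatio S.j S.k S.j i V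

/-- The slope of a column of the normalized representative of `V`; meaningful for columns in `M`. -/
noncomputable def slopeOf (S : Shape D r) (V : Gr 2 n) (i : Fin n) : ℝ :=
  - S.coord₀ V i / S.coord₁ V i

/-- The parameters of a point of the cell. Since `Real.log x = log |x|`, the signs of the columns in
`C` need not be removed first. -/
noncomputable def params (S : Shape D r) (V : Gr 2 n) : S.Params :=
  (fun i => Real.log (if i.1 ∈ S.C then S.coord₀ V i else S.coord₁ V i),
    fun s => Real.log (S.slopeOf V (S.rep s.succ) - S.slopeOf V (S.rep s.castSucc)))

theorem params_fullMat (S : Shape D r) (x : S.Params) : S.params (rowSpace (S.fullMat x)) = x := by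
  have h0 : ∀ i, S.coord₀ (rowSpace (S.fullMat x)) i = S.mat x 0 i := fun i => by
    rw [coord₀, plRatio_rowSpace]
    simp only [fullMat]
    rw [pl_mat_j_k, pl_mat_k, div_one]
  have h1 : ∀ i, S.coord₁ (rowSpace (S.fullMat x)) i = S.mat x 1 i := fun i => by
    rw [coord₁, plRatio_rowSpace]
    simp only [fullMat]
    rw [pl_mat_j_k, pl_mat_j, div_one]
  have hs : ∀ s, S.slopeOf (rowSpace (S.fullMat x)) (S.rep s) = S.slope x s := fun s => by
    have := (Real.exp_pos (S.logScale x (S.rep s))).ne'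
    rw [slopeOf, h0, h1, S.mat_zero_of_mem_M x (S.rep_mem s), S.mat_one_of_mem_M x (S.rep_mem s),
      ρ_rep]
    field_simp
  refine Prod.ext ?_ ?_
  · funext i
    have hx : S.logScale x i.1 = x.1 i := dif_pos i.2
    simp only [params]
    split_ifs with hi
    · rw [h0, S.mat_zero_of_mem_C x hi, hx, sign]
      split_ifs <;> simp
    · rw [h1, S.mat_one_of_mem_M x (i.2.1.resolve_left hi), hx, Real.log_exp]
  · funext s
    simp only [params]
    rw [hs, hs, slope_succ, add_sub_cancel_left, Real.log_exp]

/-- The properties of the normalized representative of `V` that characterize the points of the cell. -/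
structure IsNormalized (S : Shape D r) (V : Gr 2 n) : Prop where
  jk : plRatio S.j S.k S.j S.k V = 1
  coord₀_j : S.coord₀ V S.j = 1
  coord₀_k : S.coord₀ V S.k = 0
  coord₁_k : S.coord₁ V S.k = 1
  coord₁_pos : ∀ i ∈ S.M, 0 < S.coord₁ V i
  coord₁_eq_zero : ∀ i ∉ S.M, S.coord₁ V i = 0
  coord₀_pos : ∀ i ∈ S.C, 0 < S.sign i * S.coord₀ V i
  coord₀_eq_zero : ∀ i, i ∉ S.C → i ∉ S.M → S.coord₀ V i = 0
  slopeOf_eq : ∀ i ∈ S.M, ∀ l ∈ S.M, S.ρ i = S.ρ l → S.slopeOf V i = S.slopeOf V l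
  slopeOf_lt : ∀ i ∈ S.M, ∀ l ∈ S.M, S.ρ i < S.ρ l → S.slopeOf V i < S.slopeOf V l

theorem isNormalized_of_mem_cell (S : Shape D r) {V : Gr 2 n} (hV : V ∈ cell Dᶜ) :
    S.IsNormalized V := by
  obtain ⟨A, rfl, hA⟩ := (mem_cell_compl_iff D V).mp hV
  have hanti : ∀ i l, pl A.1 i l = - pl A.1 l i := fun i l => by simp only [pl]; ring
  have hself : ∀ i, pl A.1 i i = 0 := fun i => by simp [pl]
  have hzero : ∀ i l, i ≠ l → PairMem D i l → pl A.1 i l = 0 := by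
    intro i l h hp
    rcases lt_or_gt_of_ne h with h | h
    · exact (hA i l h).2 hp
    · rw [hanti, (hA l i h).2 hp.symm, neg_zero]
  have hpos : ∀ i l, i < l → ¬ PairMem D i l → 0 < pl A.1 i l := fun i l h => (hA i l h).1
  have hjk : 0 < pl A.1 S.j S.k := by
    refine hpos _ _ S.j_lt_k ?_
    rw [S.pairMem_iff _ _ S.j_lt_k.ne]
    have := S.j_mem
    have := S.k_mem
    tauto
  have hCM : ∀ i ∈ S.C, ∀ l ∈ S.M, ¬ PairMem D i l := by
    intro i hi l hl
    rw [S.pairMem_iff i l (by rintro rfl; exact S.disj _ hi hl)]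
    tauto
  have c₀ : ∀ i, S.coord₀ (rowSpace A) i = pl A.1 i S.k / pl A.1 S.j S.k := fun i =>
    plRatio_rowSpace _ _ _ _ _
  have c₁ : ∀ i, S.coord₁ (rowSpace A) i = pl A.1 S.j i / pl A.1 S.j S.k := fun i =>
    plRatio_rowSpace _ _ _ _ _
  have h1pos : ∀ i ∈ S.M, 0 < S.coord₁ (rowSpace A) i := by
    intro i hi
    rw [c₁]
    refine div_pos (hpos _ _ ?_ (hCM _ S.j_mem i hi)) hjk
    exact (S.lt_iff _ S.j_mem i hi).mpr S.j_lt_k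
  have hsl : ∀ i ∈ S.M, ∀ l ∈ S.M, S.slopeOf (rowSpace A) l - S.slopeOf (rowSpace A) i =
      pl A.1 i l / pl A.1 S.j S.k / (S.coord₁ (rowSpace A) i * S.coord₁ (rowSpace A) l) := by
    intro i hi l hl
    have hi' := (h1pos i hi).ne'
    have hl' := (h1pos l hl).ne'
    have hq : pl A.1 i l / pl A.1 S.j S.k =
        S.coord₀ (rowSpace A) i * S.coord₁ (rowSpace A) l -
        S.coord₀ (rowSpace A) l * S.coord₁ (rowSpace A) i := by
      have := hjk.ne'
      rw [c₀, c₀, c₁, c₁]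
      field_simp
      simp only [pl]; ring
    rw [hq, slopeOf, slopeOf]
    field_simp
    ring
  refine ⟨?_, ?_, ?_, ?_, h1pos, ?_, ?_, ?_, ?_, ?_⟩
  · rw [plRatio_rowSpace]; exact div_self hjk.ne'
  · rw [c₀]; exact div_self hjk.ne'
  · rw [c₀, hself, zero_div]
  · rw [c₁]; exact div_self hjk.ne'
  · intro i hi
    rw [c₁]
    by_cases hij : S.j = i
    · rw [← hij, hself, zero_div]
    · rw [hzero _ _ hij, zero_div]
      rw [S.pairMem_iff _ _ hij]
      have := S.disj _ S.j_mem
      tauto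
  · intro i hi
    rw [c₀, sign]
    split_ifs with h
    · rw [one_mul]
      exact div_pos (hpos _ _ h (hCM i hi _ S.k_mem)) hjk
    · have hne : S.k ≠ i := by rintro rfl; exact S.disj _ hi S.k_mem
      rw [hanti, neg_div, neg_one_mul, neg_neg]
      refine div_pos (hpos _ _ (lt_of_le_of_ne (not_lt.mp h) hne) ?_) hjk
      exact fun hp => hCM i hi _ S.k_mem hp.symm
  · intro i hiC hiM
    have hne : i ≠ S.k := by rintro rfl; exact hiM S.k_mem
    rw [c₀, hzero i _ hne, zero_div]
    rw [S.pairMem_iff _ _ hne]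
    tauto
  · intro i hi l hl h
    have := hsl i hi l hl
    have h0 : pl A.1 i l = 0 := by
      by_cases hil : i = l
      · rw [hil, hself]
      · refine hzero _ _ hil ?_
        rw [S.pairMem_iff _ _ hil]
        have := S.disj i
        have := S.disj l
        tauto
    rw [h0, zero_div, zero_div] at this
    linarith
  · intro i hi l hl h
    have hil : i < l := by
      by_contra hn
      exact absurd (S.ρ_mono l hl i hi (not_lt.mp hn)) (not_le.mpr h)
    have hp : 0 < pl A.1 i l := by
      refine hpos i l hil ?_
      rw [S.pairMem_iff _ _ hil.ne]
      have := h.ne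
      tauto
    have := div_pos (div_pos hp hjk) (mul_pos (h1pos i hi) (h1pos l hl))
    rw [← hsl i hi l hl] at this
    linarith

namespace IsNormalized

variable {S : Shape D r} {V : Gr 2 n}

theorem slopeOf_rep_sub_pos (h : S.IsNormalized V) (s : Fin r) :
    0 < S.slopeOf V (S.rep s.succ) - S.slopeOf V (S.rep s.castSucc) := by
  refine sub_pos.mpr (h.slopeOf_lt _ (S.rep_mem _) _ (S.rep_mem _) ?_)
  rw [ρ_rep, ρ_rep]
  exact Fin.castSucc_lt_succ

theorem slope_params (h : S.IsNormalized V) (s : Fin (r + 1)) :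
    S.slope (S.params V) s = S.slopeOf V (S.rep s) := by
  induction s using Fin.induction with
  | zero =>
    rw [slope_zero, h.slopeOf_eq _ (S.rep_mem 0) S.k S.k_mem (by rw [ρ_rep, S.ρ_k]), slopeOf,
      h.coord₀_k]
    simp
  | succ s ih =>
    rw [slope_succ, ih]
    simp only [params]
    rw [Real.exp_log (h.slopeOf_rep_sub_pos s)]
    ring

theorem exp_logScale_params_of_mem_C (h : S.IsNormalized V) {i : Fin n} (hi : i ∈ S.C) :
    Real.exp (S.logScale (S.params V) i) = S.sign i * S.coord₀ V i := by
  by_cases hij : i = S.j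
  · rw [hij, logScale_j, sign_j, h.coord₀_j]; simp
  · have hik : i ≠ S.k := by rintro rfl; exact S.disj _ hi S.k_mem
    have hfree : (i ∈ S.C ∨ i ∈ S.M) ∧ i ≠ S.j ∧ i ≠ S.k := ⟨Or.inl hi, hij, hik⟩
    have hpos := h.coord₀_pos i hi
    have : S.logScale (S.params V) i = Real.log (S.sign i * S.coord₀ V i) := by
      rw [logScale, dif_pos hfree]
      simp only [params, hi, if_true, sign]
      split_ifs <;> simp
    rw [this, Real.exp_log hpos]

theorem exp_logScale_params_of_mem_M (h : S.IsNormalized V) {i : Fin n} (hi : i ∈ S.M) :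
    Real.exp (S.logScale (S.params V) i) = S.coord₁ V i := by
  have hiC : i ∉ S.C := fun hC => S.disj i hC hi
  by_cases hik : i = S.k
  · rw [hik, logScale_k, h.coord₁_k, Real.exp_zero]
  · have hij : i ≠ S.j := by rintro rfl; exact hiC S.j_mem
    have hfree : (i ∈ S.C ∨ i ∈ S.M) ∧ i ≠ S.j ∧ i ≠ S.k := ⟨Or.inr hi, hij, hik⟩
    rw [logScale, dif_pos hfree]
    simp only [params, hiC, if_false]
    exact Real.exp_log (h.coord₁_pos i hi)

theorem rowSpace_fullMat_params (h : S.IsNormalized V) :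
    rowSpace (S.fullMat (S.params V)) = V := by
  have h0 : ∀ i, S.mat (S.params V) 0 i = S.coord₀ V i := by
    intro i
    by_cases hiC : i ∈ S.C
    · rw [S.mat_zero_of_mem_C _ hiC, h.exp_logScale_params_of_mem_C hiC, sign]
      split_ifs <;> simp
    by_cases hiM : i ∈ S.M
    · rw [S.mat_zero_of_mem_M _ hiM, h.exp_logScale_params_of_mem_M hiM, h.slope_params,
        h.slopeOf_eq _ (S.rep_mem _) i hiM (S.ρ_rep _), slopeOf]
      have := (h.coord₁_pos i hiM).ne'
      field_simp
    · rw [S.mat_of_not_mem _ hiC hiM, h.coord₀_eq_zero i hiC hiM]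
  have h1 : ∀ i, S.mat (S.params V) 1 i = S.coord₁ V i := by
    intro i
    by_cases hiM : i ∈ S.M
    · rw [S.mat_one_of_mem_M _ hiM, h.exp_logScale_params_of_mem_M hiM]
    · rw [h.coord₁_eq_zero i hiM]; simp [mat, hiM]
  obtain ⟨A, rfl⟩ := rowSpace_surjective V
  refine rowSpace_eq_of_normal (j := S.j) (k := S.k) (fun i => ?_) (fun i => ?_)
  · rw [← plRatio_rowSpace]; exact h0 i
  · rw [← plRatio_rowSpace]; exact h1 i

end IsNormalized

theorem continuousOn_params (S : Shape D r) : ContinuousOn S.params (cell Dᶜ) := by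
  have hN : ∀ V ∈ cell Dᶜ, S.IsNormalized V := fun V hV => S.isNormalized_of_mem_cell hV
  have hr : ∀ i l, ContinuousOn (plRatio S.j S.k i l) (cell Dᶜ) := fun i l =>
    (continuousOn_plRatio S.j S.k i l).mono fun V hV => by
      have := (hN V hV).jk
      simp [this]
  have h₀ : ∀ i, ContinuousOn (fun V => S.coord₀ V i) (cell Dᶜ) := fun i => hr i S.k
  have h₁ : ∀ i, ContinuousOn (fun V => S.coord₁ V i) (cell Dᶜ) := fun i => hr S.j i
  have hs : ∀ i ∈ S.M, ContinuousOn (fun V => S.slopeOf V i) (cell Dᶜ) := fun i hi =>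
    (h₀ i).neg.div (h₁ i) fun V hV => ((hN V hV).coord₁_pos i hi).ne'
  refine ContinuousOn.prodMk (continuousOn_pi.mpr fun i => ?_) (continuousOn_pi.mpr fun s => ?_)
  · by_cases hi : i.1 ∈ S.C
    · simp only [hi, if_true]
      exact (h₀ i).log fun V hV => right_ne_zero_of_mul ((hN V hV).coord₀_pos i hi).ne'
    · simp only [hi, if_false]
      exact (h₁ i).log fun V hV => ((hN V hV).coord₁_pos i (i.2.1.resolve_left hi)).ne'
  · exact ((hs _ (S.rep_mem _)).sub (hs _ (S.rep_mem _))).log fun V hV =>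
      ((hN V hV).slopeOf_rep_sub_pos s).ne'

/-- The cell is homeomorphic to its parameter space. -/
noncomputable def cellHomeomorph (S : Shape D r) : cell Dᶜ ≃ₜ S.Params where
  toFun V := S.params V.1
  invFun x := ⟨rowSpace (S.fullMat x),
    (mem_cell_compl_iff D _).mpr ⟨S.fullMat x, rfl, S.hasPattern_mat x⟩⟩
  left_inv V := Subtype.ext (S.isNormalized_of_mem_cell V.2).rowSpace_fullMat_params
  right_inv x := S.params_fullMat x
  continuous_toFun := continuousOn_iff_continuous_domRestrict.mp S.continuousOn_params
  continuous_invFun :=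
    (isQuotientMap_rowSpace.continuous.comp S.continuous_fullMat).subtype_mk _

theorem card_free_add_two (S : Shape D r) : Nat.card S.Free + 2 = S.C.card + S.M.card := by
  classical
  have hcard : Nat.card S.Free = (((S.C ∪ S.M).erase S.j).erase S.k).card := by
    rw [Nat.card_eq_fintype_card, Fintype.card_subtype]
    congr 1
    ext i
    simp only [Finset.mem_filter, Finset.mem_univ, true_and, Finset.mem_erase, Finset.mem_union]
    tauto
  have hj : S.j ∈ S.C ∪ S.M := Finset.mem_union_left _ S.j_mem
  have hk : S.k ∈ (S.C ∪ S.M).erase S.j :=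
    Finset.mem_erase.mpr ⟨S.j_lt_k.ne', Finset.mem_union_right _ S.k_mem⟩
  have h1 := Finset.card_erase_add_one hk
  have h2 := Finset.card_erase_add_one hj
  rw [hcard, ← Finset.card_union_of_disjoint (Finset.disjoint_left.mpr S.disj)]
  omega

theorem card_add_card_le (S : Shape D r) : S.C.card + S.M.card ≤ n := by
  classical
  rw [← Finset.card_union_of_disjoint (Finset.disjoint_left.mpr S.disj)]
  exact (Finset.card_le_univ _).trans_eq (Fintype.card_fin n)

end Shape
end PositroidCells

theorem proposition4p1 (n : ℕ) (D : Set (Set.powersetCard (Fin n) 2))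
    (hD : PositroidCells.IsPositroid Dᶜ) :
    ∃ d : ℕ,
      (d : ℤ) = (n : ℤ) - ((PositroidCells.loops D).ncard : ℤ)
        + (PositroidCells.numComponents D : ℤ) - 4 ∧
      PositroidCells.IsCellOfDim (PositroidCells.cell Dᶜ) d := by
  obtain ⟨r, ⟨S⟩⟩ := PositroidCells.exists_shape D hD
  refine ⟨Nat.card S.Free + r, ?_, ⟨S.cellHomeomorph.trans
    (ContinuousLinearEquiv.ofFinrankEq (𝕜 := ℝ) ?_).toHomeomorph⟩⟩
  · rw [S.ncard_loops, S.numComponents_eq]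
    have := S.card_free_add_two
    have := S.card_add_card_le
    omega
  · simp
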